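/- Let $\Bbbk$ be a field of characteristic zero and let $W_+$ be the positive Witt algebra over $\Bbbk$, i.e. the Lie algebra with $\Bbbk$-basis $\{e_n : n\in\mathbb{Z}_{\ge 1}\}$ and bracket $[e_i,e_j]=(j-i)e_{i+j}$. Let $\mathrm{U}(W_+)$ be its universal enveloping algebra, equipped with the order filtration: $o(f)\le n$ means that $f$ is a linear combination of products of at most $n$ elements of $W_+$. For a $\Bbbk$-algebra $R$ let $$\operatorname{GKdim} R=\sup_V\ \varlimsup_{n\to\infty}\ \log_n \dim_{\Bbbk}\Big(\sum_{i=0}^n V^i\Big),$$ where $V$ runs over the finite-dimensional subspaces of $R$ (and $\log_n 0$ is read as $0$, so that the zero algebra has GK-dimension $0$). If $f$ is a nonzero element of $\mathrm{U}(W_+)$ with $o(f)\le 2$, and $(f)$ denotes the two-sided ideal generated by $f$, then $$\operatorname{GKdim}\,\mathrm{U}(W_+)/(f)<\infty .$$ -/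

import Mathlib

noncomputable section

/-- The positive Witt algebra `W₊` over `k`: the `k`-vector space with basis `e n`, `n ≥ 1`. -/
def PositiveWitt (k : Type*) [CommRing k] : Type _ := ℕ+ →₀ k

namespace PositiveWitt

variable (k : Type*) [CommRing k]

instance : AddCommGroup (PositiveWitt k) := inferInstanceAs (AddCommGroup (ℕ+ →₀ k))

instance : Module k (PositiveWitt k) := inferInstanceAs (Module k (ℕ+ →₀ k))

/-- The standard basis `e 1, e 2, …` of `W₊`. -/
def e : Module.Basis ℕ+ k (PositiveWitt k) := ⟨LinearEquiv.refl k (ℕ+ →₀ k)⟩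

/-- The bilinear map with `(e i, e j) ↦ (j - i) e (i + j)`. -/
def bracket : PositiveWitt k →ₗ[k] PositiveWitt k →ₗ[k] PositiveWitt k :=
  (e k).constr k fun i => (e k).constr k fun j => (((j : ℕ) : k) - ((i : ℕ) : k)) • e k (i + j)

theorem bracket_e (i j : ℕ+) :
    bracket k (e k i) (e k j) = (((j : ℕ) : k) - ((i : ℕ) : k)) • e k (i + j) := by
  simp [bracket, Module.Basis.constr_basis]

theorem bracket_skew (x y : PositiveWitt k) : bracket k x y = -bracket k y x := by
  have h : bracket k = -(bracket k).flip := by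
    refine (e k).ext fun i => (e k).ext fun j => ?_
    simp only [LinearMap.neg_apply, LinearMap.flip_apply, bracket_e, add_comm j i, ← neg_smul,
      neg_sub]
  exact congrArg (fun B => B x y) h

theorem induction_e {p : PositiveWitt k → Prop} (x : PositiveWitt k) (zero : p 0)
    (add : ∀ a b, p a → p b → p (a + b)) (smul : ∀ (c : k) (i : ℕ+), p (c • e k i)) : p x := by
  have hx : x ∈ Submodule.span k (Set.range (e k)) := by simp [(e k).span_eq]
  rw [← Finsupp.range_linearCombination] at hx
  obtain ⟨g, rfl⟩ := hx
  rw [Finsupp.linearCombination_apply]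
  exact Finset.sum_induction _ p add zero fun i _ => smul _ i

theorem bracket_self (x : PositiveWitt k) : bracket k x x = 0 := by
  induction x using induction_e with
  | zero => simp
  | add a b ha hb => simp [ha, hb, bracket_skew k a b]
  | smul c i => simp [bracket_e]

theorem bracket_leibniz (x y z : PositiveWitt k) :
    bracket k x (bracket k y z) = bracket k (bracket k x y) z + bracket k y (bracket k x z) := by
  induction x using induction_e with
  | zero => simp
  | add a b ha hb => simp only [map_add, LinearMap.add_apply, ha, hb]; abel
  | smul c i =>
  induction y using induction_e with
  | zero => simp
  | add a b ha hb => simp only [map_add, LinearMap.add_apply, ha, hb]; abel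
  | smul d j =>
  induction z using induction_e with
  | zero => simp
  | add a b ha hb => simp only [map_add, ha, hb]; abel
  | smul f l =>
  simp only [map_smul, LinearMap.smul_apply, bracket_e, smul_smul, ← add_assoc, add_comm j i,
    ← add_smul]
  congr 1
  push_cast
  ring

instance : LieRing (PositiveWitt k) where
  bracket x y := bracket k x y
  add_lie x y z := by simp
  lie_add x y z := by simp
  lie_self x := bracket_self k x
  leibniz_lie x y z := bracket_leibniz k x y z

instance : LieAlgebra k (PositiveWitt k) where
  lie_smul c x y := (bracket k x).map_smul c y

theorem lie_e (i j : ℕ+) :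
    ⁅e k i, e k j⁆ = (((j : ℕ) : k) - ((i : ℕ) : k)) • e k (i + j) := bracket_e k i j

end PositiveWitt

section

attribute [local instance] LieRing.ofAssociativeRing

/-- The `n`-th piece of the order filtration of the enveloping algebra `U(L)`: the span of all
products of at most `n` elements of `L`. An element has order at most `n` iff it lies in it. -/
def UniversalEnvelopingAlgebra.orderFiltration (k L : Type*) [CommRing k] [LieRing L]
    [LieAlgebra k L] (n : ℕ) : Submodule k (UniversalEnvelopingAlgebra k L) :=
  ⨆ i ∈ Finset.range (n + 1),
    (LinearMap.range (UniversalEnvelopingAlgebra.ι k : L →ₗ⁅k⁆ _).toLinearMap) ^ i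

end

/-- The growth function `n ↦ dim (V⁰ + V¹ + ⋯ + Vⁿ)` of a subspace `V` of an algebra. -/
def growthFun (k : Type*) {A : Type*} [Field k] [Ring A] [Algebra k A] (V : Submodule k A)
    (n : ℕ) : ℕ :=
  Module.finrank k ↥(⨆ i ∈ Finset.range (n + 1), V ^ i)

/-- The Gelfand–Kirillov dimension of a `k`-algebra: the supremum, over all finite-dimensional
subspaces `V` (equivalently, over the finitely generated subalgebras they generate), of
`limsup log_n dim (V⁰ + ⋯ + Vⁿ)`. It is infinite iff it equals `⊤`. -/
def gkDim (k A : Type*) [Field k] [Ring A] [Algebra k A] : EReal :=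
  ⨆ (V : Submodule k A) (_ : FiniteDimensional k V),
    Filter.limsup (fun n : ℕ => ((Real.logb n (growthFun k V n) : ℝ) : EReal)) Filter.atTop

end

/-! Let `x i` be the image of `e (i + 1)` in the quotient, with weight `i + C`. For `C ≥ 2`
commutators lower the weight, so letters commute up to lower weight. The relation `f = 0` has a
quadratic leading monomial `x i₀ * x j₀` once `C` is large enough for the linear part to be
negligible (`exists_lead_of_quadratic_relation`).

Bracketing this relation twice, with `x n` and then `x m`, rewrites `x p * x q` for all large `p ≤
q` as products with the same index sum but one index below `p`, up to lower weight
(`mem_span_sup_weightLT_of_lead`). Such steps increase the sum of the squares of the indices, which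
is bounded in each weight, so rewriting terminates: words with at most one large letter span
(`weightLT_le_standardSpan`). Those of weight less than `d` are polynomially many in `d`. Only
spanning is needed, so the Poincaré–Birkhoff–Witt theorem plays no role. -/

/-! ### Weight filtration and commutators -/

section WeightFiltration

variable (k : Type*) {A : Type*} [Field k] [Ring A] [Algebra k A]

/-- The weight of a word, where the letter `i` has weight `i + C`. -/
def wordWeight (C : ℕ) (l : List ℕ) : ℕ := (l.map (· + C)).sum

/-- The span of all words of weight less than `d` in the letters `x 0, x 1, …`. -/
def weightLT (x : ℕ → A) (C d : ℕ) : Submodule k A :=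
  Submodule.span k ((fun l : List ℕ => (l.map x).prod) '' {l | wordWeight C l < d})

@[simp] theorem wordWeight_nil (C : ℕ) : wordWeight C [] = 0 := rfl

@[simp] theorem wordWeight_cons (C i : ℕ) (l : List ℕ) :
    wordWeight C (i :: l) = i + C + wordWeight C l := rfl

@[simp] theorem wordWeight_append (C : ℕ) (l l' : List ℕ) :
    wordWeight C (l ++ l') = wordWeight C l + wordWeight C l' := by simp [wordWeight]

theorem List.Perm.wordWeight_eq {C : ℕ} {l l' : List ℕ} (h : l.Perm l') :
    wordWeight C l = wordWeight C l' := (h.map _).sum_eq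

variable {k} {x : ℕ → A} {C : ℕ}

theorem word_mem_weightLT {d : ℕ} (l : List ℕ) (h : wordWeight C l < d) :
    (l.map x).prod ∈ weightLT k x C d := Submodule.subset_span ⟨l, h, rfl⟩

theorem weightLT_mono {d d' : ℕ} (h : d ≤ d') : weightLT k x C d ≤ weightLT k x C d' :=
  Submodule.span_mono (Set.image_mono fun _ hl => lt_of_lt_of_le hl h)

theorem word_mul_mem_weightLT {d e : ℕ} (l : List ℕ) {a : A} (ha : a ∈ weightLT k x C d)
    (h : wordWeight C l + d ≤ e) : (l.map x).prod * a ∈ weightLT k x C e := by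
  induction ha using Submodule.span_induction with
  | mem a ha =>
    obtain ⟨l', hl', rfl⟩ := ha
    rw [Set.mem_ofPred_eq] at hl'
    simp only [← List.prod_append, ← List.map_append]
    exact word_mem_weightLT _ (by rw [wordWeight_append]; omega)
  | zero => simp
  | add a b _ _ ha hb => rw [mul_add]; exact add_mem ha hb
  | smul c a _ ha => rw [mul_smul_comm]; exact Submodule.smul_mem _ _ ha

theorem mul_word_mem_weightLT {d e : ℕ} (l : List ℕ) {a : A} (ha : a ∈ weightLT k x C d)
    (h : d + wordWeight C l ≤ e) : a * (l.map x).prod ∈ weightLT k x C e := by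
  induction ha using Submodule.span_induction with
  | mem a ha =>
    obtain ⟨l', hl', rfl⟩ := ha
    rw [Set.mem_ofPred_eq] at hl'
    simp only [← List.prod_append, ← List.map_append]
    exact word_mem_weightLT _ (by rw [wordWeight_append]; omega)
  | zero => simp
  | add a b _ _ ha hb => rw [add_mul]; exact add_mem ha hb
  | smul c a _ ha => rw [smul_mul_assoc]; exact Submodule.smul_mem _ _ ha

theorem weightLT_mul_le (d e : ℕ) :
    weightLT k x C (d + 1) * weightLT k x C (e + 1) ≤ weightLT k x C (d + e + 1) := by
  rw [Submodule.mul_le]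
  intro a ha b hb
  induction ha using Submodule.span_induction with
  | mem a ha =>
    obtain ⟨l', hl', rfl⟩ := ha
    rw [Set.mem_ofPred_eq] at hl'
    exact word_mul_mem_weightLT _ hb (by omega)
  | zero => simp
  | add a b _ _ ha hb => rw [add_mul]; exact add_mem ha hb
  | smul c a _ ha => rw [smul_mul_assoc]; exact Submodule.smul_mem _ _ ha

theorem weightLT_pow_le (d n : ℕ) : weightLT k x C (d + 1) ^ n ≤ weightLT k x C (n * d + 1) := by
  induction n with
  | zero =>
    rw [pow_zero, Submodule.one_le]
    exact word_mem_weightLT [] (by simp)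
  | succ n ih =>
    rw [pow_succ]
    refine (mul_le_mul' ih le_rfl).trans ((weightLT_mul_le _ _).trans (weightLT_mono ?_))
    rw [Nat.succ_mul]

theorem exists_mem_weightLT (hgen : Algebra.adjoin k (Set.range x) = ⊤) (a : A) :
    ∃ d, a ∈ weightLT k x C (d + 1) := by
  have ha : a ∈ Algebra.adjoin k (Set.range x) := hgen ▸ Algebra.mem_top
  induction ha using Algebra.adjoin_induction with
  | mem a ha =>
    obtain ⟨i, rfl⟩ := ha
    exact ⟨i + C, by simpa using word_mem_weightLT (k := k) (x := x) (C := C) [i] (by simp)⟩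
  | algebraMap c =>
    refine ⟨0, ?_⟩
    rw [Algebra.algebraMap_eq_smul_one]
    exact Submodule.smul_mem _ _ (word_mem_weightLT [] (by simp))
  | add a b _ _ ha hb =>
    obtain ⟨d, hd⟩ := ha
    obtain ⟨e, he⟩ := hb
    exact ⟨d + e, add_mem (weightLT_mono (by omega) hd) (weightLT_mono (by omega) he)⟩
  | mul a b _ _ ha hb =>
    obtain ⟨d, hd⟩ := ha
    obtain ⟨e, he⟩ := hb
    exact ⟨d + e, weightLT_mul_le _ _ (Submodule.mul_mem_mul hd he)⟩

theorem exists_le_weightLT (hgen : Algebra.adjoin k (Set.range x) = ⊤) (V : Submodule k A)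
    [FiniteDimensional k V] : ∃ d, V ≤ weightLT k x C (d + 1) := by
  obtain ⟨s, rfl⟩ := (Submodule.fg_iff_finiteDimensional V).2 inferInstance
  choose g hg using exists_mem_weightLT (C := C) hgen
  refine ⟨s.sup g, Submodule.span_le.2 fun a ha => weightLT_mono ?_ (hg a)⟩
  have := Finset.le_sup (f := g) (Finset.mem_coe.1 ha)
  omega

variable (hx : ∀ i j, x i * x j - x j * x i = ((j : k) - i) • x (i + j + 1))
include hx

/-- By the Leibniz rule, one letter `i` at a time becomes `n + i + 1`: bracketing with `x n` adds
only `n + 1` to the weight, not `n + C`. -/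
theorem commutator_word_mem_weightLT (n : ℕ) (l : List ℕ) :
    x n * (l.map x).prod - (l.map x).prod * x n ∈
      weightLT k x C (wordWeight C l + n + 2) := by
  induction l with
  | nil => simp
  | cons i l ih =>
    have h : x n * ((i :: l).map x).prod - ((i :: l).map x).prod * x n =
        ((i : k) - n) • (((n + i + 1) :: l).map x).prod +
          ([i].map x).prod * (x n * (l.map x).prod - (l.map x).prod * x n) := by
      simp only [List.map_cons, List.prod_cons, List.map_nil, List.prod_nil, mul_one,
        ← smul_mul_assoc, ← hx]
      noncomm_ring
    rw [h]
    refine add_mem (Submodule.smul_mem _ _ (word_mem_weightLT _ ?_))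
      (word_mul_mem_weightLT _ ih ?_) <;> simp <;> omega

theorem commutator_mem_weightLT (n : ℕ) {d : ℕ} {a : A} (ha : a ∈ weightLT k x C d) :
    x n * a - a * x n ∈ weightLT k x C (d + n + 1) := by
  induction ha using Submodule.span_induction with
  | mem a ha =>
    obtain ⟨l', hl', rfl⟩ := ha
    rw [Set.mem_ofPred_eq] at hl'
    exact weightLT_mono (by omega) (commutator_word_mem_weightLT hx n l')
  | zero => simp
  | add a b _ _ ha hb =>
    convert add_mem ha hb using 1
    noncomm_ring
  | smul c a _ ha =>
    rw [mul_smul_comm, smul_mul_assoc, ← smul_sub]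
    exact Submodule.smul_mem _ _ ha

/-- Swapping neighbours `i`, `j` costs a single letter of weight `i + j + 1 + C`, which is below `i
+ j + 2 * C` precisely because `C ≥ 2`. -/
theorem List.Perm.word_sub_mem_weightLT (hC : 2 ≤ C) {l l' : List ℕ} (h : l.Perm l') :
    (l.map x).prod - (l'.map x).prod ∈ weightLT k x C (wordWeight C l) := by
  induction h with
  | nil => simp
  | @cons i l l' h ih =>
    have := word_mul_mem_weightLT (e := wordWeight C (i :: l)) [i] ih (by simp)
    simpa [mul_sub] using this
  | swap i j l =>
    have h : ((j :: i :: l).map x).prod - ((i :: j :: l).map x).prod =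
        ((i : k) - j) • (((j + i + 1) :: l).map x).prod := by
      simp only [List.map_cons, List.prod_cons, ← smul_mul_assoc, ← hx]
      noncomm_ring
    rw [h]
    exact Submodule.smul_mem _ _ (word_mem_weightLT _ (by simp; omega))
  | trans h₁ h₂ ih₁ ih₂ =>
    rw [← h₁.wordWeight_eq] at ih₂
    simpa using add_mem ih₁ ih₂

end WeightFiltration

/-! ### Counting standard words and termination of rewriting -/

section Rewriting

variable {k : Type*} {A : Type*} [Field k] [Ring A] [Algebra k A] {x : ℕ → A} {C : ℕ}

/-- The multisets of weight less than `d` with at most one element `≥ N`. -/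
def standardMultisets (C N d : ℕ) : Set (Multiset ℕ) :=
  {s | (s.map (· + C)).sum < d ∧ (s.filter (N ≤ ·)).card ≤ 1}

/-- The span of the words without two letters `≥ N`, of weight less than `d`. -/
def standardSpan (k : Type*) {A : Type*} [Field k] [Ring A] [Algebra k A] (x : ℕ → A)
    (C N d : ℕ) : Submodule k A :=
  Submodule.span k ((fun s : Multiset ℕ => (s.toList.map x).prod) '' standardMultisets C N d)

theorem standardSpan_mono {N d d' : ℕ} (h : d ≤ d') :
    standardSpan k x C N d ≤ standardSpan k x C N d' :=
  Submodule.span_mono (Set.image_mono fun _ hs => ⟨lt_of_lt_of_le hs.1 h, hs.2⟩)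

/-- The shift by `1` distinguishes the empty multiset from `{0}`. -/
theorem eq_of_card_le_one_of_sum_eq {s t : Multiset ℕ} (hs : s.card ≤ 1) (ht : t.card ≤ 1)
    (h : (s.map (· + 1)).sum = (t.map (· + 1)).sum) : s = t := by
  rcases Nat.le_one_iff_eq_zero_or_eq_one.1 hs with hs | hs <;>
  rcases Nat.le_one_iff_eq_zero_or_eq_one.1 ht with ht | ht <;>
  simp only [Multiset.card_eq_zero, Multiset.card_eq_one] at hs ht
  · rw [hs, ht]
  · obtain ⟨b, rfl⟩ := ht
    subst hs
    simp at h
  · obtain ⟨a, rfl⟩ := hs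
    subst ht
    simp at h
  · obtain ⟨a, rfl⟩ := hs
    obtain ⟨b, rfl⟩ := ht
    simpa using h

/-- Such a multiset is determined by `N + 1` numbers below `d`: the multiplicities of the letters
below `N`, and the shifted sum of its large part. -/
theorem finite_standardMultisets_and_ncard_le (hC : 1 ≤ C) (N d : ℕ) :
    (standardMultisets C N d).Finite ∧ (standardMultisets C N d).ncard ≤ d ^ (N + 1) := by
  have hcard : ∀ s : Multiset ℕ, s.card ≤ (s.map (· + C)).sum := fun s => by
    simpa using Multiset.sum_map_le_sum_map (fun _ => 1) (· + C) (s := s) fun i _ => by omega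
  have hsum : ∀ s : Multiset ℕ,
      ((s.filter (N ≤ ·)).map (· + 1)).sum ≤ (s.map (· + C)).sum := fun s =>
    (Multiset.sum_map_le_sum_map (· + 1) (· + C) fun i _ => by omega).trans
      (by conv_rhs => rw [← Multiset.filter_add_not (N ≤ ·) s, Multiset.map_add, Multiset.sum_add]
          exact Nat.le_add_right _ _)
  let φ : standardMultisets C N d → (Fin N → Fin d) × Fin d := fun s =>
    (fun i => ⟨s.1.count (i : ℕ),
        (Multiset.count_le_card _ _).trans_lt ((hcard _).trans_lt s.2.1)⟩,
      ⟨_, (hsum s.1).trans_lt s.2.1⟩)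
  have hφ : Function.Injective φ := by
    rintro ⟨s, hs⟩ ⟨t, ht⟩ h
    simp only [φ, Prod.mk.injEq, Fin.mk.injEq, funext_iff] at h
    have hst := eq_of_card_le_one_of_sum_eq hs.2 ht.2 h.2
    refine Subtype.ext (Multiset.ext.2 fun i => ?_)
    by_cases hi : i < N
    · exact h.1 ⟨i, hi⟩
    · rw [← Multiset.count_filter_of_pos (p := (N ≤ ·)) (not_lt.1 hi), hst,
        Multiset.count_filter_of_pos (p := (N ≤ ·)) (not_lt.1 hi)]
  refine ⟨have := Finite.of_injective φ hφ; Set.toFinite _, ?_⟩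
  rw [← Nat.card_coe_set_eq]
  refine (Nat.card_le_card_of_injective φ hφ).trans (le_of_eq ?_)
  simp [pow_succ]

theorem finite_and_finrank_standardSpan_le (hC : 1 ≤ C) (N d : ℕ) :
    FiniteDimensional k (standardSpan k x C N d) ∧
      Module.finrank k (standardSpan k x C N d) ≤ d ^ (N + 1) := by
  obtain ⟨hfin, hcard⟩ := finite_standardMultisets_and_ncard_le hC N d
  have hfin' := hfin.image (fun s : Multiset ℕ => (s.toList.map x).prod)
  refine ⟨FiniteDimensional.span_of_finite k hfin', ?_⟩
  have := hfin'.fintype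
  refine (finrank_span_le_card _).trans ?_
  rw [← Set.ncard_eq_toFinset_card']
  exact (Set.ncard_image_le hfin).trans hcard

theorem sum_map_sq_le_sq_wordWeight (C : ℕ) (l : List ℕ) :
    (l.map (· ^ 2)).sum ≤ wordWeight C l ^ 2 := by
  induction l with
  | nil => simp
  | cons i l ih =>
    simp only [List.map_cons, List.sum_cons, wordWeight_cons]
    nlinarith [Nat.zero_le (i * C), Nat.zero_le (i * wordWeight C l),
      Nat.zero_le (C * wordWeight C l), Nat.zero_le (C ^ 2)]

theorem exists_perm_cons_cons {N : ℕ} {l : List ℕ}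
    (h : 1 < ((l : Multiset ℕ).filter (N ≤ ·)).card) :
    ∃ p q l', N ≤ p ∧ p ≤ q ∧ l.Perm (p :: q :: l') := by
  obtain ⟨a, ha⟩ := Multiset.card_pos_iff_exists_mem.1 (Nat.zero_lt_one.trans h)
  obtain ⟨s, hs⟩ := Multiset.exists_cons_of_mem ha
  rw [hs, Multiset.card_cons] at h
  obtain ⟨b, hb⟩ := Multiset.card_pos_iff_exists_mem.1 (by omega : 0 < s.card)
  obtain ⟨t, rfl⟩ := Multiset.exists_cons_of_mem hb
  have hle : a ::ₘ b ::ₘ t ≤ (l : Multiset ℕ) := hs ▸ Multiset.filter_le _ _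
  have ha' : N ≤ a := (Multiset.mem_filter.1 ha).2
  have hb' : N ≤ b := (Multiset.mem_filter.1
    (hs ▸ Multiset.mem_cons_of_mem (Multiset.mem_cons_self _ _))).2
  obtain ⟨u, hu⟩ := Multiset.le_iff_exists_add.1 hle
  have hl : l.Perm (a :: b :: (t + u).toList) := by
    rw [← Multiset.coe_eq_coe, hu, ← Multiset.cons_coe, ← Multiset.cons_coe, Multiset.coe_toList]
    simp
  rcases le_total a b with hab | hab
  · exact ⟨a, b, _, ha', hab, hl⟩
  · exact ⟨b, a, _, hb', hab, hl.trans (List.Perm.swap _ _ _)⟩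

/-- Induction on the weight makes reordering free; within weight `d`, the rewriting `hrel` decreases
`d ^ 2` minus the sum of the squared letters. -/
theorem weightLT_le_standardSpan
    (hx : ∀ i j, x i * x j - x j * x i = ((j : k) - i) • x (i + j + 1)) (hC : 2 ≤ C) {N : ℕ}
    (hrel : ∀ p q, N ≤ p → p ≤ q → x p * x q ∈
      Submodule.span k {a | ∃ i j, i < p ∧ i + j = p + q ∧ a = x i * x j} ⊔
        weightLT k x C (p + q + 2 * C)) (d : ℕ) :
    weightLT k x C d ≤ standardSpan k x C N d := by
  induction d with
  | zero => simp [weightLT]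
  | succ d ih =>
  have ih' : weightLT k x C d ≤ standardSpan k x C N (d + 1) :=
    ih.trans (standardSpan_mono (Nat.le_succ d))
  have key : ∀ (M : ℕ) (l : List ℕ), wordWeight C l = d → d ^ 2 - (l.map (· ^ 2)).sum = M →
      (l.map x).prod ∈ standardSpan k x C N (d + 1) := by
    intro M
    induction M using Nat.strong_induction_on with
    | _ M ihM =>
    intro l hl hM
    by_cases hstd : ((l : Multiset ℕ).filter (N ≤ ·)).card ≤ 1
    · have hperm : l.Perm (l : Multiset ℕ).toList := by
        rw [← Multiset.coe_eq_coe, Multiset.coe_toList]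
      have h := hperm.word_sub_mem_weightLT hx hC
      rw [hl] at h
      have hmem : (l : Multiset ℕ) ∈ standardMultisets C N (d + 1) :=
        ⟨by rw [Multiset.map_coe, Multiset.sum_coe]; exact Nat.lt_succ_of_le hl.le, hstd⟩
      exact (Submodule.sub_mem_iff_left _
        (Submodule.subset_span (Set.mem_image_of_mem _ hmem))).1 (ih' h)
    · obtain ⟨p, q, l', hp, hpq, hperm⟩ := exists_perm_cons_cons (not_le.1 hstd)
      have h := hperm.word_sub_mem_weightLT hx hC
      have hl' := hperm.wordWeight_eq (C := C)
      have hsq := (hperm.map (· ^ 2)).sum_eq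
      rw [hl] at h hl'
      simp only [wordWeight_cons, List.map_cons, List.sum_cons] at hl' hsq
      suffices hw : ((p :: q :: l').map x).prod ∈ standardSpan k x C N (d + 1) from
        (Submodule.sub_mem_iff_left _ hw).1 (ih' h)
      rw [List.map_cons, List.map_cons, List.prod_cons, List.prod_cons, ← mul_assoc]
      obtain ⟨a, ha, b, hb, hab⟩ := Submodule.mem_sup.1 (hrel p q hp hpq)
      rw [← hab, add_mul]
      refine add_mem ?_ (ih' (mul_word_mem_weightLT _ hb (by omega)))
      clear hab
      induction ha using Submodule.span_induction with
      | mem a ha =>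
        obtain ⟨i, j, hi, hij, rfl⟩ := ha
        have hlt : p ^ 2 + q ^ 2 < i ^ 2 + j ^ 2 := by
          obtain ⟨r, rfl⟩ := Nat.exists_eq_add_of_lt hi
          obtain rfl : j = r + 1 + q := by omega
          nlinarith
        -- Without this bound the truncated subtraction could stall at `0`.
        have hbd := sum_map_sq_le_sq_wordWeight C (i :: j :: l')
        have hwt : wordWeight C (i :: j :: l') = d := by simp only [wordWeight_cons]; omega
        have := ihM _ ?_ (i :: j :: l') hwt rfl
        · simpa [mul_assoc] using this
        · rw [hwt] at hbd
          simp only [List.map_cons, List.sum_cons] at hbd ⊢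
          omega
      | zero => simp
      | add a b _ _ ha hb => rw [add_mul]; exact add_mem ha hb
      | smul c a _ ha => rw [smul_mul_assoc]; exact Submodule.smul_mem _ _ ha
  refine Submodule.span_le.2 ?_
  rintro _ ⟨l, hl, rfl⟩
  rw [Set.mem_ofPred_eq, Nat.lt_succ_iff_lt_or_eq] at hl
  rcases hl with hl | hl
  · exact ih' (word_mem_weightLT l hl)
  · exact key _ l hl rfl

end Rewriting

/-! ### Propagating one leading term to all large pairs -/

section LeadingTerm

variable {k : Type*} {A : Type*} [Field k] [Ring A] [Algebra k A] {x : ℕ → A} {C : ℕ}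

theorem mem_span_sup_weightLT_of_lead [CharZero k]
    (hx : ∀ i j, x i * x j - x j * x i = ((j : k) - i) • x (i + j + 1)) (hC : 2 ≤ C)
    {i₀ j₀ : ℕ} (hij : i₀ ≤ j₀)
    (hlead : x i₀ * x j₀ ∈
      Submodule.span k {a | ∃ i j, i ≤ j ∧ i + j = i₀ + j₀ ∧ j < j₀ ∧ a = x i * x j} ⊔
        weightLT k x C (i₀ + j₀ + 2 * C))
    {p q : ℕ} (hp : 2 * j₀ + 2 ≤ p) (hpq : p ≤ q) :
    x p * x q ∈ Submodule.span k {a | ∃ i j, i < p ∧ i + j = p + q ∧ a = x i * x j} ⊔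
      weightLT k x C (p + q + 2 * C) := by
  set L := Submodule.span k {a | ∃ i j, i < p ∧ i + j = p + q ∧ a = x i * x j} ⊔
    weightLT k x C (p + q + 2 * C)
  -- Chosen so that `ad n` sends `x j₀` to a multiple of `x p`, and `ad m` sends `x i₀` to a
  -- multiple of `x q`.
  obtain ⟨n, rfl⟩ : ∃ n, p = j₀ + n + 1 := ⟨p - j₀ - 1, by omega⟩
  obtain ⟨m, rfl⟩ : ∃ m, q = i₀ + m + 1 := ⟨q - i₀ - 1, by omega⟩
  have hL₁ : ∀ i j, i < j₀ + n + 1 → i + j = j₀ + n + 1 + (i₀ + m + 1) → x i * x j ∈ L :=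
    fun i j hi hj => Submodule.mem_sup_left (Submodule.subset_span ⟨i, j, hi, hj, rfl⟩)
  have hcomm : ∀ i j, i + j = j₀ + n + 1 + (i₀ + m + 1) → x j * x i - x i * x j ∈ L := by
    intro i j hj
    rw [hx]
    refine Submodule.smul_mem _ _ (Submodule.mem_sup_right ?_)
    have := word_mem_weightLT (k := k) (x := x) (C := C)
      (d := j₀ + n + 1 + (i₀ + m + 1) + 2 * C) [j + i + 1] (by simp; omega)
    simpa using this
  have hL₂ : ∀ i j, i < j₀ + n + 1 → i + j = j₀ + n + 1 + (i₀ + m + 1) → x j * x i ∈ L :=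
    fun i j hi hj => (Submodule.sub_mem_iff_left _ (hL₁ i j hi hj)).1 (hcomm i j hj)
  let ad : ℕ → A →ₗ[k] A := fun n => LinearMap.mulLeft k (x n) - LinearMap.mulRight k (x n)
  have had : ∀ n a, ad n a = x n * a - a * x n := fun n a => by simp [ad]
  have had_mul : ∀ n a b, ad n (a * b) = ad n a * b + a * ad n b := fun n a b => by
    simp only [had]
    noncomm_ring
  have had_x : ∀ n i, ad n (x i) = ((i : k) - n) • x (n + i + 1) := fun n i => by rw [had, hx]
  have hD : ∀ i j, ad m (ad n (x i * x j)) =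
      (((i : k) - n) * ((n + i + 1 : ℕ) - m)) • (x (m + (n + i + 1) + 1) * x j) +
      (((i : k) - n) * (j - m)) • (x (n + i + 1) * x (m + j + 1)) +
      (((j : k) - n) * (i - m)) • (x (m + i + 1) * x (n + j + 1)) +
      (((j : k) - n) * ((n + j + 1 : ℕ) - m)) • (x i * x (m + (n + j + 1) + 1)) := by
    intro i j
    simp only [had_mul, had_x, map_add, map_smul, smul_mul_assoc, mul_smul_comm, smul_smul,
      smul_add]
    rw [← add_assoc]
  -- Two brackets raise the weight bound by `n + m + 2`, exactly the growth of the index sum from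
  -- `i₀ + j₀` to `p + q`.
  have hlower : ∀ a ∈ weightLT k x C (i₀ + j₀ + 2 * C), ad m (ad n a) ∈ L := by
    intro a ha
    rw [had m, had n]
    exact Submodule.mem_sup_right (weightLT_mono (by omega)
      (commutator_mem_weightLT hx m (commutator_mem_weightLT hx n ha)))
  have hspan : ∀ a ∈ Submodule.span k
      {a | ∃ i j, i ≤ j ∧ i + j = i₀ + j₀ ∧ j < j₀ ∧ a = x i * x j}, ad m (ad n a) ∈ L := by
    intro a ha
    induction ha using Submodule.span_induction with
    | mem a ha =>
      obtain ⟨i, j, hi, hj, hj₀, rfl⟩ := ha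
      rw [hD]
      refine add_mem (add_mem (add_mem ?_ ?_) ?_) ?_ <;> refine Submodule.smul_mem _ _ ?_
      · exact hL₂ _ _ (by omega) (by omega)
      · exact hL₁ _ _ (by omega) (by omega)
      · exact hL₂ _ _ (by omega) (by omega)
      · exact hL₁ _ _ (by omega) (by omega)
    | zero => simp
    | add a b _ _ ha hb => simp only [map_add]; exact add_mem ha hb
    | smul c a _ ha => simp only [map_smul]; exact Submodule.smul_mem _ _ ha
  have htop : ad m (ad n (x i₀ * x j₀)) ∈ L := by
    obtain ⟨a, ha, b, hb, hab⟩ := Submodule.mem_sup.1 hlead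
    rw [← hab, map_add, map_add]
    exact add_mem (hspan a ha) (hlower b hb)
  -- The bound `2 * j₀ + 2 ≤ p` gives `n > j₀` and `m > i₀`, so the coefficient of the wanted
  -- product survives in characteristic zero.
  have hjn : (j₀ : k) - n ≠ 0 := sub_ne_zero.2 (by exact_mod_cast (by omega : j₀ ≠ n))
  have him : (i₀ : k) - m ≠ 0 := sub_ne_zero.2 (by exact_mod_cast (by omega : i₀ ≠ m))
  rw [hD, Submodule.add_mem_iff_left _ (Submodule.smul_mem _ _ (hL₁ _ _ (by omega) (by omega))),
    add_assoc, Submodule.add_mem_iff_right _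
      (Submodule.smul_mem _ _ (hL₂ _ _ (by omega) (by omega)))] at htop
  have hqp : x (m + i₀ + 1) * x (n + j₀ + 1) - x (j₀ + n + 1) * x (i₀ + m + 1) ∈ L := by
    rw [add_comm m, add_comm n]
    exact hcomm _ _ rfl
  suffices h : x (m + i₀ + 1) * x (n + j₀ + 1) ∈ L from (Submodule.sub_mem_iff_right _ h).1 hqp
  rcases hij.lt_or_eq with hlt | rfl
  · rw [Submodule.add_mem_iff_right _
      (Submodule.smul_mem _ _ (hL₁ _ _ (by omega) (by omega)))] at htop
    exact (Submodule.smul_mem_iff _ (mul_ne_zero hjn him)).1 htop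
  -- For `i₀ = j₀` both cross terms are the wanted product up to order; they add up, whence the
  -- factor `2`.
  · have hsw := Submodule.smul_mem L (((i₀ : k) - n) * (i₀ - m))
      (hcomm (n + i₀ + 1) (m + i₀ + 1) (by omega))
    refine (Submodule.smul_mem_iff _ (mul_ne_zero two_ne_zero (mul_ne_zero hjn him))).1 ?_
    convert add_mem htop hsw using 1
    module

end LeadingTerm

/-! ### From polynomial growth to finite GK-dimension -/

/-- The factor `2` absorbs `d`, since `n * d + 1 ≤ n ^ 2` for `n ≥ d + 2`; finiteness needs no
sharper exponent. -/
theorem gkDim_le_of_growthFun_le {k A : Type*} [Field k] [Ring A] [Algebra k A] (r : ℕ)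
    (h : ∀ V : Submodule k A, FiniteDimensional k V →
      ∃ d : ℕ, ∀ n, growthFun k V n ≤ (n * d + 1) ^ r) :
    gkDim k A ≤ ((2 * r : ℝ) : EReal) := by
  refine iSup₂_le fun V hV => ?_
  obtain ⟨d, hd⟩ := h V hV
  refine Filter.limsup_le_of_le (h := ?_)
  filter_upwards [Filter.eventually_ge_atTop (d + 2)] with n hn
  rw [EReal.coe_le_coe_iff]
  have hn1 : (1 : ℝ) < n := by exact_mod_cast (by omega : 1 < n)
  have hle : (growthFun k V n : ℝ) ≤ (n : ℝ) ^ (2 * r) := by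
    rw [pow_mul]
    exact_mod_cast (hd n).trans (Nat.pow_le_pow_left (by nlinarith) r)
  rcases Nat.eq_zero_or_pos (growthFun k V n) with h0 | h0
  · rw [h0]
    simp
  · refine (Real.logb_le_logb_of_le hn1 (by exact_mod_cast h0) hle).trans ?_
    rw [Real.logb_pow, Real.logb_self_eq_one hn1]
    simp

theorem UniversalEnvelopingAlgebra.adjoin_range_ι (k L : Type*) [CommRing k] [LieRing L] [LieAlgebra k L] :
    Algebra.adjoin k (Set.range (UniversalEnvelopingAlgebra.ι k : L → _)) = ⊤ := by
  have h : Set.range (UniversalEnvelopingAlgebra.ι k : L → _) =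
    UniversalEnvelopingAlgebra.mkAlgHom k L '' Set.range (TensorAlgebra.ι k) := by
    rw [← Set.range_comp]; rfl
  rw [h, ← AlgHom.map_adjoin, TensorAlgebra.adjoin_range_ι, Algebra.map_top,
    AlgHom.range_eq_top]
  exact RingCon.mkₐ_surjective _

theorem gkDim_lt_top_of_lead {k A : Type*} [Field k] [CharZero k] [Ring A] [Algebra k A]
    {x : ℕ → A} {C : ℕ} (hx : ∀ i j, x i * x j - x j * x i = ((j : k) - i) • x (i + j + 1))
    (hgen : Algebra.adjoin k (Set.range x) = ⊤) (hC : 2 ≤ C) {i₀ j₀ : ℕ} (hij : i₀ ≤ j₀)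
    (hlead : x i₀ * x j₀ ∈
      Submodule.span k {a | ∃ i j, i ≤ j ∧ i + j = i₀ + j₀ ∧ j < j₀ ∧ a = x i * x j} ⊔
        weightLT k x C (i₀ + j₀ + 2 * C)) :
    gkDim k A < ⊤ := by
  refine (gkDim_le_of_growthFun_le (2 * j₀ + 2 + 1) fun V hV => ?_).trans_lt (EReal.coe_lt_top _)
  obtain ⟨d, hd⟩ := exists_le_weightLT (C := C) hgen V
  refine ⟨d, fun n => ?_⟩
  -- `hfin` is essential: `finrank` is monotone only into a finite-dimensional space.
  obtain ⟨hfin, hrank⟩ := finite_and_finrank_standardSpan_le (k := k) (x := x) (C := C) (by omega)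
    (2 * j₀ + 2) (n * d + 1)
  refine (Submodule.finrank_mono (iSup₂_le fun i hi => ?_)).trans hrank
  refine le_trans ?_ (weightLT_le_standardSpan hx hC
    (fun p q hp hpq => mem_span_sup_weightLT_of_lead hx hC hij hlead hp hpq) _)
  refine (pow_le_pow_left' hd i).trans ((weightLT_pow_le d i).trans (weightLT_mono ?_))
  have : i ≤ n := Nat.lt_succ_iff.1 (Finset.mem_range.1 hi)
  gcongr

/-! ### Leading term of a relation of order at most two -/

section QuadraticRelation

variable {k : Type*} {A : Type*} [Field k] [Ring A] [Algebra k A] {x : ℕ → A}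

theorem range_pow_le_span_ordered
    (hx : ∀ i j, x i * x j - x j * x i = ((j : k) - i) • x (i + j + 1)) :
    ⨆ i ∈ Finset.range 3, Submodule.span k (Set.range x) ^ i ≤
      Submodule.span k ((fun ij : ℕ × ℕ => x ij.1 * x ij.2) '' {ij | ij.1 ≤ ij.2}) ⊔
        (Submodule.span k (Set.range x) ⊔ Submodule.span k {1}) := by
  refine iSup₂_le fun i hi => ?_
  have hi : i < 3 := Finset.mem_range.1 hi
  interval_cases i
  · rw [pow_zero, Submodule.one_eq_span]
    exact le_sup_right.trans le_sup_right
  · rw [pow_one]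
    exact le_sup_left.trans le_sup_right
  · rw [pow_two, Submodule.span_mul_span, Submodule.span_le]
    rintro _ ⟨_, ⟨i, rfl⟩, _, ⟨j, rfl⟩, rfl⟩
    have hord : ∀ i j, i ≤ j → x i * x j ∈
        Submodule.span k ((fun ij : ℕ × ℕ => x ij.1 * x ij.2) '' {ij | ij.1 ≤ ij.2}) ⊔
        (Submodule.span k (Set.range x) ⊔ Submodule.span k {1}) := fun i j h =>
      Submodule.mem_sup_left (Submodule.subset_span ⟨(i, j), h, rfl⟩)
    rcases le_total i j with h | h
    · exact hord i j h
    · refine (Submodule.sub_mem_iff_left _ (hord j i h)).1 ?_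
      rw [hx]
      exact Submodule.smul_mem _ _ (Submodule.mem_sup_right
        (Submodule.mem_sup_left (Submodule.subset_span ⟨_, rfl⟩)))

theorem exists_lead_of_quadratic_relation (a : ℕ × ℕ →₀ k) (b : ℕ →₀ k) (c : k)
    (ha : ∀ ij ∈ a.support, ij.1 ≤ ij.2) (hne : a ≠ 0 ∨ b ≠ 0 ∨ c ≠ 0)
    (h : Finsupp.linearCombination k (fun ij : ℕ × ℕ => x ij.1 * x ij.2) a +
      (Finsupp.linearCombination k x b + c • 1) = 0) :
    ∃ C i₀ j₀, 2 ≤ C ∧ i₀ ≤ j₀ ∧ x i₀ * x j₀ ∈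
      Submodule.span k {a | ∃ i j, i ≤ j ∧ i + j = i₀ + j₀ ∧ j < j₀ ∧ a = x i * x j} ⊔
        weightLT k x C (i₀ + j₀ + 2 * C) := by
  have hone : ∀ C d : ℕ, 0 < d → (1 : A) ∈ weightLT k x C d := fun C d hd => by
    simpa using word_mem_weightLT (k := k) (x := x) (C := C) [] hd
  have hx1 : ∀ C d i : ℕ, i + C < d → x i ∈ weightLT k x C d := fun C d i hd => by
    simpa using word_mem_weightLT (k := k) (x := x) (C := C) (d := d) [i] (by simpa using hd)
  have hx2 : ∀ C d i j : ℕ, i + j + 2 * C < d → x i * x j ∈ weightLT k x C d :=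
    fun C d i j hd => by
      simpa using word_mem_weightLT (k := k) (x := x) (C := C) (d := d) [i, j]
        (by simp; omega)
  by_cases ha0 : a = 0
  · subst ha0
    rw [map_zero, zero_add] at h
    by_cases hb0 : b = 0
    · subst hb0
      have hc : c ≠ 0 := by simpa using hne
      rw [map_zero, zero_add] at h
      have h1 : (1 : A) = 0 := (smul_eq_zero.1 h).resolve_left hc
      -- Here `1 = 0`, so any monomial can serve as leading term.
      refine ⟨2, 0, 0, le_rfl, le_rfl, ?_⟩
      rw [← mul_one (x 0 * x 0), h1, mul_zero]
      exact zero_mem _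
    · obtain ⟨i₀, hi₀, hmax⟩ := b.support.exists_max_image id (Finsupp.support_nonempty_iff.2 hb0)
      -- A linear relation becomes quadratic after left multiplication by `x 0`.
      refine ⟨2, 0, i₀, le_rfl, Nat.zero_le _, Submodule.mem_sup_right ?_⟩
      rw [Finsupp.linearCombination_apply, Finsupp.sum, ← Finset.add_sum_erase _ _ hi₀] at h
      refine (Submodule.smul_mem_iff _ (Finsupp.mem_support_iff.1 hi₀)).1 ?_
      rw [← mul_smul_comm, eq_neg_of_add_eq_zero_left ((add_assoc _ _ _).symm.trans h), mul_neg,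
        mul_add, Finset.mul_sum]
      refine neg_mem (add_mem (sum_mem fun i hi => ?_) ?_)
      · rw [mul_smul_comm]
        have h₁ := Finset.ne_of_mem_erase hi
        have h₂ : i ≤ i₀ := hmax i (Finset.mem_of_mem_erase hi)
        exact Submodule.smul_mem _ _ (hx2 _ _ _ _ (by omega))
      · rw [mul_smul_comm, mul_one]
        exact Submodule.smul_mem _ _ (hx1 _ _ _ (by omega))
  · obtain ⟨⟨i₀, j₀⟩, hij₀, hmax⟩ := a.support.exists_max_image
      (fun ij => toLex (ij.1 + ij.2, ij.2)) (Finsupp.support_nonempty_iff.2 ha0)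
    -- This `C` puts every linear term, of weight `i + C`, below the leading weight `i₀ + j₀ + 2 *
    -- C`.
    refine ⟨2 + b.support.sup id, i₀, j₀, by omega, ha _ hij₀, ?_⟩
    rw [Finsupp.linearCombination_apply, Finsupp.sum, ← Finset.add_sum_erase _ _ hij₀] at h
    refine (Submodule.smul_mem_iff _ (Finsupp.mem_support_iff.1 hij₀)).1 ?_
    rw [eq_neg_of_add_eq_zero_left ((add_assoc _ _ _).symm.trans h)]
    refine neg_mem (add_mem (sum_mem fun ij hij => Submodule.smul_mem _ _ ?_)
      (Submodule.mem_sup_right (add_mem ?_ (Submodule.smul_mem _ _ (hone _ _ (by omega))))))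
    · obtain ⟨i, j⟩ := ij
      have h₁ := Finset.ne_of_mem_erase hij
      have h₂ := hmax _ (Finset.mem_of_mem_erase hij)
      have h₃ : i ≤ j := ha _ (Finset.mem_of_mem_erase hij)
      simp only [Prod.Lex.toLex_le_toLex] at h₂
      rw [Ne, Prod.mk.injEq] at h₁
      rcases h₂ with h₂ | ⟨h₂, h₄⟩
      · exact Submodule.mem_sup_right (hx2 _ _ _ _ (by omega))
      · exact Submodule.mem_sup_left
          (Submodule.subset_span ⟨i, j, h₃, h₂, by omega, rfl⟩)
    · rw [Finsupp.linearCombination_apply, Finsupp.sum]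
      refine sum_mem fun i hi => Submodule.smul_mem _ _ (hx1 _ _ _ ?_)
      have : i ≤ b.support.sup id := Finset.le_sup (f := id) hi
      omega

end QuadraticRelation

/-! ### Application to the enveloping algebra -/

section

attribute [local instance] LieRing.ofAssociativeRing

namespace PositiveWitt

variable (k : Type*) [Field k]

/-- The generators of `U(W₊)`, indexed by `ℕ`: `gen n` is the image of `e (n + 1)`. -/
noncomputable def gen (n : ℕ) : UniversalEnvelopingAlgebra k (PositiveWitt k) :=
  UniversalEnvelopingAlgebra.ι k (e k n.succPNat)

theorem gen_commutator (i j : ℕ) :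
    gen k i * gen k j - gen k j * gen k i = ((j : k) - i) • gen k (i + j + 1) := by
  have h : i.succPNat + j.succPNat = (i + j + 1).succPNat := by
    apply PNat.eq
    simp only [PNat.add_coe, Nat.succPNat_coe]
    omega
  rw [gen, gen, ← LieRing.of_associative_ring_bracket, ← LieHom.map_lie, lie_e, h, map_smul, gen]
  simp

theorem range_ι_eq_span_gen :
    LinearMap.range (UniversalEnvelopingAlgebra.ι k :
      PositiveWitt k →ₗ⁅k⁆ UniversalEnvelopingAlgebra k (PositiveWitt k)).toLinearMap =
      Submodule.span k (Set.range (gen k)) := by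
  have h : Set.range (gen k) = (UniversalEnvelopingAlgebra.ι k :
      PositiveWitt k →ₗ⁅k⁆ UniversalEnvelopingAlgebra k (PositiveWitt k)).toLinearMap ''
        Set.range (e k) := by
    rw [← Set.range_comp]
    exact Equiv.pnatEquivNat.symm.surjective.range_comp
      ((UniversalEnvelopingAlgebra.ι k : PositiveWitt k →ₗ⁅k⁆ _).toLinearMap ∘ e k)
  rw [h, ← Submodule.map_span, (e k).span_eq, Submodule.map_top]

theorem adjoin_range_gen : Algebra.adjoin k (Set.range (gen k)) = ⊤ := by
  rw [← Algebra.adjoin_span, ← range_ι_eq_span_gen, LinearMap.coe_range]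
  exact UniversalEnvelopingAlgebra.adjoin_range_ι k (PositiveWitt k)

theorem exists_ordered_form {f : UniversalEnvelopingAlgebra k (PositiveWitt k)}
    (hord : f ∈ UniversalEnvelopingAlgebra.orderFiltration k (PositiveWitt k) 2) :
    ∃ (a : ℕ × ℕ →₀ k) (b : ℕ →₀ k) (c : k), (∀ ij ∈ a.support, ij.1 ≤ ij.2) ∧
      f = Finsupp.linearCombination k (fun ij : ℕ × ℕ => gen k ij.1 * gen k ij.2) a +
        (Finsupp.linearCombination k (gen k) b + c • 1) := by
  rw [UniversalEnvelopingAlgebra.orderFiltration, range_ι_eq_span_gen] at hord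
  obtain ⟨u, hu, v, hv, huv⟩ :=
    Submodule.mem_sup.1 (range_pow_le_span_ordered (gen_commutator k) hord)
  obtain ⟨v', hv', w, hw, hvw⟩ := Submodule.mem_sup.1 hv
  obtain ⟨a, ha, hu⟩ := (Finsupp.mem_span_image_iff_linearCombination k).1 hu
  obtain ⟨b, hb⟩ := (Finsupp.mem_span_range_iff_exists_finsupp (R := k)).1 hv'
  obtain ⟨c, hc⟩ := Submodule.mem_span_singleton.1 hw
  refine ⟨a, b, c, fun ij hij => (Finsupp.mem_supported k a).1 ha hij, ?_⟩
  rw [hu, hc, Finsupp.linearCombination_apply, hb, hvw, huv]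

end PositiveWitt

end

open PositiveWitt in
theorem gkDim_lt_top_of_surjective {k A : Type*} [Field k] [CharZero k] [Ring A] [Algebra k A]
    (π : UniversalEnvelopingAlgebra k (PositiveWitt k) →ₐ[k] A) (hπ : Function.Surjective π)
    {f : UniversalEnvelopingAlgebra k (PositiveWitt k)} (hf : f ≠ 0)
    (hord : f ∈ UniversalEnvelopingAlgebra.orderFiltration k (PositiveWitt k) 2) (hπf : π f = 0) :
    gkDim k A < ⊤ := by
  have hx : ∀ i j, π (gen k i) * π (gen k j) - π (gen k j) * π (gen k i) =
      ((j : k) - i) • π (gen k (i + j + 1)) := fun i j => by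
    rw [← map_mul, ← map_mul, ← map_sub, gen_commutator, map_smul]
  have hgen : Algebra.adjoin k (Set.range fun n => π (gen k n)) = ⊤ := by
    rw [← Function.comp_def, Set.range_comp, ← AlgHom.map_adjoin, adjoin_range_gen, Algebra.map_top,
      AlgHom.range_eq_top]
    exact hπ
  obtain ⟨a, b, c, ha, hfabc⟩ := exists_ordered_form k hord
  -- The only use of `f ≠ 0`: some coefficient of the ordered form is nonzero.
  have hne : a ≠ 0 ∨ b ≠ 0 ∨ c ≠ 0 := by
    by_contra! h
    obtain ⟨rfl, rfl, rfl⟩ := h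
    simp [hfabc] at hf
  have h0 : Finsupp.linearCombination k (fun ij : ℕ × ℕ => π (gen k ij.1) * π (gen k ij.2)) a +
      (Finsupp.linearCombination k (fun n => π (gen k n)) b + c • 1) = 0 := by
    rw [← hπf, hfabc]
    simp only [Finsupp.linearCombination_apply, Finsupp.sum, map_add, map_sum, map_smul, map_mul,
      map_one]
  obtain ⟨C, i₀, j₀, hC, hij, hlead⟩ :=
    exists_lead_of_quadratic_relation (x := fun n => π (gen k n)) a b c ha hne h0
  exact gkDim_lt_top_of_lead hx hgen hC hij hlead

theorem corollary4p9 (k : Type*) [Field k] [CharZero k]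
    (f : UniversalEnvelopingAlgebra k (PositiveWitt k)) (hf : f ≠ 0)
    (hord : f ∈ UniversalEnvelopingAlgebra.orderFiltration k (PositiveWitt k) 2) :
    gkDim k (TwoSidedIdeal.span {f}).ringCon.Quotient < ⊤ := by
  refine gkDim_lt_top_of_surjective (RingCon.mkₐ k _) (RingCon.mkₐ_surjective _) hf hord ?_
  have h : f ∈ TwoSidedIdeal.span {f} := TwoSidedIdeal.subset_span rfl
  exact (RingCon.eq _).2 ((TwoSidedIdeal.mem_iff _ _).1 h)
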